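/- Let $n,m\ge 2$ and let $(\mathbb N;=,+,V_n)$ be the standard model of Büchi arithmetic $\mathrm{BA}_n$, where $V_n(x)$ is the largest power of $n$ dividing $x$ for $x>0$, and $V_n(0)=0$. For a first-order language $\mathcal K$ and $d\ge 1$, a $d$-dimensional interpretation $\iota$ of $\mathcal K$ in $\mathrm{BA}_n$ consists of parameter-free first-order formulas in the language $(=,+,V_n)$: a formula $D_\iota$ defining a set $\mathbf D_\iota\subseteq\mathbb N^d$, a formula $=_\iota$ defining an equivalence relation $\sim_\iota$ on $\mathbf D_\iota$, for each predicate symbol $P$ of $\mathcal K$ a formula $P_\iota$ whose restriction to $\mathbf D_\iota$ is invariant under $\sim_\iota$, and for each function symbol $f$ of $\mathcal K$ a formula $f_\iota$ which on $\mathbf D_\iota$ is invariant under $\sim_\iota$ and defines, modulo $\sim_\iota$, the graph of a total function. (Each variable of $\mathcal K$ corresponds to a $d$-tuple of variables.) Its internal model is the $\mathcal K$-structure with domain $\mathbf D_\iota/{\sim_\iota}$ in which the symbols of $\mathcal K$ are interpreted by these formulas. **Theorem.** Let $A$ be a $\mathcal K$-structure and let $\iota$ be an $m$-dimensional interpretation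 of $\mathcal K$ in $\mathrm{BA}_n$ whose internal model is isomorphic to $A$. Then there is a one-dimensional interpretation $\iota'$ of $\mathcal K$ in $\mathrm{BA}_n$ whose internal model is isomorphic to the internal model of $\iota$, and hence to $A$. -/

import Mathlib

open FirstOrder FirstOrder.Language

/-- `buchiV n x` is the largest power of `n` that divides `x`, with `buchiV n 0 = 0`. -/
noncomputable def buchiV (n x : ℕ) : ℕ :=
  if x = 0 then 0 else n ^ multiplicity n x

theorem buchiV_zero (n : ℕ) : buchiV n 0 = 0 := by simp [buchiV]

theorem buchiV_isGreatest {n x : ℕ} (hn : 2 ≤ n) (hx : x ≠ 0) :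
    IsGreatest {q : ℕ | (∃ k : ℕ, q = n ^ k) ∧ q ∣ x} (buchiV n x) := by
  have hfin : FiniteMultiplicity n x :=
    Nat.finiteMultiplicity_iff.2 ⟨by omega, Nat.pos_of_ne_zero hx⟩
  rw [buchiV, if_neg hx]
  refine ⟨⟨⟨_, rfl⟩, pow_multiplicity_dvd n x⟩, ?_⟩
  rintro q ⟨⟨k, rfl⟩, hk⟩
  exact Nat.pow_le_pow_right (by omega) (hfin.le_multiplicity_of_pow_dvd hk)

/-- The non-logical symbols of the Büchi arithmetic of base `n`: `+` and `V_n`. -/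
inductive BuchiFunc (n : ℕ) : ℕ → Type
  | add : BuchiFunc n 2
  | V : BuchiFunc n 1

/-- The first-order language (with equality) of the Büchi arithmetic of base `n`. -/
def buchi (n : ℕ) : FirstOrder.Language.{0, 0} where
  Functions := BuchiFunc n
  Relations := fun _ => Empty

/-- The standard model `(ℕ; =, +, V_n)`. -/
noncomputable instance buchiStructure (n : ℕ) : (buchi n).Structure ℕ where
  funMap {k} (f : BuchiFunc n k) :=
    match k, f with
    | _, .add => fun v => v 0 + v 1
    | _, .V => fun v => buchiV n (v 0)
  RelMap {_} r := nomatch r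

theorem buchi_funMap_add (n : ℕ) (v : Fin 2 → ℕ) :
    Structure.funMap (L := buchi n) (BuchiFunc.add : BuchiFunc n 2) v = v 0 + v 1 := rfl

theorem buchi_funMap_V (n : ℕ) (v : Fin 1 → ℕ) :
    Structure.funMap (L := buchi n) (BuchiFunc.V : BuchiFunc n 1) v = buchiV n (v 0) := rfl

/-- An `m`-dimensional parameter-free interpretation of the first-order language `K` in the
`L`-structure `B`. It consists of `L`-formulas for the domain, for equality and for each symbol
of `K`; the first block of variables of `func f` holds the arguments and the second the value.
Elements of the domain are `m`-tuples of elements of `B`. -/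
structure Interpretation (K : FirstOrder.Language) (L : FirstOrder.Language) (B : Type*) [L.Structure B] (m : ℕ) where
  dom : L.Formula (Fin m)
  eq : L.Formula (Fin m ⊕ Fin m)
  rel : ∀ {k : ℕ}, K.Relations k → L.Formula (Fin k × Fin m)
  func : ∀ {k : ℕ}, K.Functions k → L.Formula ((Fin k × Fin m) ⊕ Fin m)
  /-- the formula `eq` defines an equivalence relation on the domain -/
  eq_refl : ∀ a : Fin m → B, dom.Realize a → eq.Realize (Sum.elim a a)
  eq_symm : ∀ a b : Fin m → B, dom.Realize a → dom.Realize b →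
    eq.Realize (Sum.elim a b) → eq.Realize (Sum.elim b a)
  eq_trans : ∀ a b c : Fin m → B, dom.Realize a → dom.Realize b → dom.Realize c →
    eq.Realize (Sum.elim a b) → eq.Realize (Sum.elim b c) → eq.Realize (Sum.elim a c)
  /-- the interpreted predicates respect the interpreted equality -/
  rel_congr : ∀ {k : ℕ} (R : K.Relations k) (x x' : Fin k → Fin m → B),
    (∀ i, dom.Realize (x i)) → (∀ i, dom.Realize (x' i)) →
    (∀ i, eq.Realize (Sum.elim (x i) (x' i))) →
    (rel R).Realize (Function.uncurry x) → (rel R).Realize (Function.uncurry x')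
  /-- each `func f` defines, on the domain and modulo `eq`, the graph of a total function -/
  func_congr : ∀ {k : ℕ} (f : K.Functions k) (x x' : Fin k → Fin m → B) (y y' : Fin m → B),
    (∀ i, dom.Realize (x i)) → (∀ i, dom.Realize (x' i)) → dom.Realize y → dom.Realize y' →
    (∀ i, eq.Realize (Sum.elim (x i) (x' i))) → eq.Realize (Sum.elim y y') →
    (func f).Realize (Sum.elim (Function.uncurry x) y) →
    (func f).Realize (Sum.elim (Function.uncurry x') y')
  func_total : ∀ {k : ℕ} (f : K.Functions k) (x : Fin k → Fin m → B),
    (∀ i, dom.Realize (x i)) →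
    ∃ y, dom.Realize y ∧ (func f).Realize (Sum.elim (Function.uncurry x) y)
  func_unique : ∀ {k : ℕ} (f : K.Functions k) (x : Fin k → Fin m → B) (y y' : Fin m → B),
    (∀ i, dom.Realize (x i)) → dom.Realize y → dom.Realize y' →
    (func f).Realize (Sum.elim (Function.uncurry x) y) →
    (func f).Realize (Sum.elim (Function.uncurry x) y') → eq.Realize (Sum.elim y y')

namespace Interpretation

variable {K : FirstOrder.Language} {L : FirstOrder.Language} {B : Type*} [L.Structure B] {m : ℕ}

/-- The set of `m`-tuples that satisfy the domain formula. -/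
def Dom (ι : Interpretation K L B m) : Type _ := {a : Fin m → B // ι.dom.Realize a}

/-- The interpreted equality, on the domain. -/
def setoid (ι : Interpretation K L B m) : Setoid ι.Dom where
  r a b := ι.eq.Realize (Sum.elim a.1 b.1)
  iseqv :=
    { refl := fun a => ι.eq_refl _ a.2
      symm := fun {a b} h => ι.eq_symm _ _ a.2 b.2 h
      trans := fun {a b c} h h' => ι.eq_trans _ _ _ a.2 b.2 c.2 h h' }

/-- The domain of the internal model: the domain of `ι` modulo the interpreted equality. -/
def InternalModel (ι : Interpretation K L B m) : Type _ := Quotient ι.setoid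

/-- The element of the internal model represented by a tuple of the domain. -/
def cls (ι : Interpretation K L B m) (a : ι.Dom) : ι.InternalModel := Quotient.mk ι.setoid a

/-- The internal model as a `K`-structure. The choice of representatives does not matter, by
`relMap_cls` and `funMap_cls`. -/
noncomputable instance internalStructure (ι : Interpretation K L B m) :
    K.Structure ι.InternalModel where
  funMap f x :=
    ι.cls ⟨_, (ι.func_total f (fun i => (Quotient.out (x i)).1)
      (fun i => (Quotient.out (x i)).2)).choose_spec.1⟩
  RelMap R x := (ι.rel R).Realize (Function.uncurry fun i => (Quotient.out (x i)).1)

theorem cls_eq_cls (ι : Interpretation K L B m) (a b : ι.Dom) :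
    ι.cls a = ι.cls b ↔ ι.eq.Realize (Sum.elim a.1 b.1) :=
  Quotient.eq (r := ι.setoid)

theorem cls_surjective (ι : Interpretation K L B m) : Function.Surjective ι.cls :=
  Quotient.exists_rep

theorem out_cls (ι : Interpretation K L B m) (a : ι.Dom) :
    ι.eq.Realize (Sum.elim (Quotient.out (ι.cls a)).1 a.1) :=
  Quotient.mk_out (s := ι.setoid) a

theorem relMap_cls (ι : Interpretation K L B m) {k : ℕ} (R : K.Relations k) (x : Fin k → ι.Dom) :
    Structure.RelMap R (fun i => ι.cls (x i)) ↔
      (ι.rel R).Realize (Function.uncurry fun i => (x i).1) :=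
  ⟨ι.rel_congr R _ _ (fun i => (Quotient.out (ι.cls (x i))).2) (fun i => (x i).2)
      (fun i => ι.out_cls (x i)),
    ι.rel_congr R _ _ (fun i => (x i).2) (fun i => (Quotient.out (ι.cls (x i))).2)
      (fun i => ι.eq_symm _ _ (Quotient.out (ι.cls (x i))).2 (x i).2 (ι.out_cls (x i)))⟩

theorem funMap_cls (ι : Interpretation K L B m) {k : ℕ} (f : K.Functions k) (x : Fin k → ι.Dom)
    (y : ι.Dom) :
    Structure.funMap f (fun i => ι.cls (x i)) = ι.cls y ↔
      (ι.func f).Realize (Sum.elim (Function.uncurry fun i => (x i).1) y.1) := by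
  have hx := fun i => (Quotient.out (ι.cls (x i))).2
  have hs := (ι.func_total f (fun i => (Quotient.out (ι.cls (x i))).1) hx).choose_spec
  refine Iff.trans (ι.cls_eq_cls ⟨_, hs.1⟩ y) ⟨fun h => ?_, fun h => ?_⟩
  · exact ι.func_congr f _ _ _ _ hx (fun i => (x i).2) hs.1 y.2 (fun i => ι.out_cls (x i)) h hs.2
  · refine ι.func_unique f _ _ _ hx hs.1 y.2 hs.2 ?_
    exact ι.func_congr f _ _ _ _ (fun i => (x i).2) hx y.2 y.2
      (fun i => ι.eq_symm _ _ (hx i) (x i).2 (ι.out_cls (x i))) (ι.eq_refl _ y.2) h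

end Interpretation

/-!
Büchi arithmetic has no definable injection of pairs into numbers, so the given interpretation
cannot be moved to dimension one along a definable coding of tuples. A coding that is not itself
definable serves just as well, as long as it sends definable relations to definable relations; this
is `Interpretation.exists_equiv_of_injective`. The coding used is `interleave`, which merges the
base-`n` expansions of the `m` numbers of a tuple into one expansion.

To see that `interleave` preserves definability, let `spread` move the digit at position `i` to
position `m * i`. Its range is definable (`mem_range_spread_iff`): a cut of a number in front of a
nonzero digit is expressed through `V_n`, and the powers of `n ^ m` are the powers of `n` congruent
to `1` modulo `n ^ m - 1` (`pow_modEq_one_iff`). `V_n` commutes with `spread` (`buchiV_spread`), and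
the addition of the original numbers is definable from their spread copies by guessing the carry
word, itself a spread number (`eq_add_iff_spread`); this needs `2 ≤ m`, which keeps the carries of
different digits apart. Thus `spread` is an isomorphism of Büchi arithmetic onto a definable copy of
it within itself, and every formula can be translated (`exists_spread_translation`). Finally
`interleave a = ∑ i, n ^ i * spread (a i)` is definable from the numbers `spread (a i)`.
-/

/-! ### Definability in Büchi arithmetic -/

section Definability

variable {n : ℕ} {α : Type*}

theorem definable_and {L : FirstOrder.Language} {B : Type*} [L.Structure B] {A : Set B}
    {P Q : (α → B) → Prop} (hP : A.Definable L {v | P v}) (hQ : A.Definable L {v | Q v}) :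
    A.Definable L {v | P v ∧ Q v} := hP.inter hQ

theorem definable_imp {L : FirstOrder.Language} {B : Type*} [L.Structure B] {A : Set B}
    {P Q : (α → B) → Prop} (hP : A.Definable L {v | P v}) (hQ : A.Definable L {v | Q v}) :
    A.Definable L {v | P v → Q v} := by
  convert hP.compl.union hQ using 1
  ext v
  exact imp_iff_not_or

theorem definable_exists {L : FirstOrder.Language} {B : Type*} [L.Structure B] {A : Set B}
    {P : (α → B) → B → Prop}
    (h : A.Definable L {w : Option α → B | P (w ∘ some) (w none)}) :
    A.Definable L {v | ∃ x, P v x} := by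
  convert (h.preimage_comp
    (fun o : Option α => (o.elim (Sum.inr ()) Sum.inl : α ⊕ Unit))).exists_of_finite using 1
  ext v
  exact ⟨fun ⟨x, hx⟩ => ⟨fun _ => x, hx⟩, fun ⟨u, hu⟩ => ⟨u (), hu⟩⟩

theorem definable_forall {L : FirstOrder.Language} {B : Type*} [L.Structure B] {A : Set B}
    {P : (α → B) → B → Prop}
    (h : A.Definable L {w : Option α → B | P (w ∘ some) (w none)}) :
    A.Definable L {v | ∀ x, P v x} := by
  convert (h.preimage_comp
    (fun o : Option α => (o.elim (Sum.inr ()) Sum.inl : α ⊕ Unit))).forall_of_finite using 1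
  ext v
  exact ⟨fun hx u => hx (u ()), fun hx x => hx (fun _ => x)⟩

theorem definableFun_weaken {L : FirstOrder.Language} {B : Type*} [L.Structure B] {A : Set B}
    {f : (α → B) → B} (hf : A.DefinableFun L f) :
    A.DefinableFun L fun w : Option α → B => f (w ∘ some) :=
  Set.Definable.preimage_comp (Option.map some) hf

theorem definable_pred {L : FirstOrder.Language} {B : Type*} [L.Structure B] {A : Set B}
    {P : B → Prop} (hP : A.Definable₁ L {x | P x}) {f : (α → B) → B} (hf : A.DefinableFun L f) :
    A.Definable L {v | P (f v)} :=
  Set.Definable.preimage_map (F := fun v _ => f v) (fun _ => hf) hP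

theorem buchi_definableFun_add {f g : (α → ℕ) → ℕ} (hf : (∅ : Set ℕ).DefinableFun (buchi n) f)
    (hg : (∅ : Set ℕ).DefinableFun (buchi n) g) :
    (∅ : Set ℕ).DefinableFun (buchi n) fun v => f v + g v :=
  Set.DefinableFun.comp (g := fun v => ![f v, g v])
    (by intro i; fin_cases i <;> assumption)
    (Set.DefinableFun.fun_symbol (L := buchi n) (BuchiFunc.add : BuchiFunc n 2))

theorem buchi_definableFun_V {f : (α → ℕ) → ℕ} (hf : (∅ : Set ℕ).DefinableFun (buchi n) f) :
    (∅ : Set ℕ).DefinableFun (buchi n) fun v => buchiV n (f v) :=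
  Set.DefinableFun.comp (g := fun v (_ : Fin 1) => f v) (fun _ => hf)
    (Set.DefinableFun.fun_symbol (L := buchi n) (BuchiFunc.V : BuchiFunc n 1))

theorem buchi_definable_le {f g : (α → ℕ) → ℕ} (hf : (∅ : Set ℕ).DefinableFun (buchi n) f)
    (hg : (∅ : Set ℕ).DefinableFun (buchi n) g) :
    (∅ : Set ℕ).Definable (buchi n) {v | f v ≤ g v} := by
  simp_rw [le_iff_exists_add]
  exact definable_exists (P := fun v x => g v = f v + x)
    ((definableFun_weaken hg).ofPred_eq
      (buchi_definableFun_add (definableFun_weaken hf) (Set.DefinableFun.proj (buchi n))))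

theorem buchi_definableFun_zero :
    (∅ : Set ℕ).DefinableFun (buchi n) fun _ : α → ℕ => 0 := by
  have h : (∅ : Set ℕ).Definable (buchi n) {w : Option α → ℕ | w none + w none = w none} :=
    (buchi_definableFun_add (.proj _) (.proj _)).ofPred_eq (.proj _)
  refine (congrArg ((∅ : Set ℕ).Definable (buchi n)) (Set.ext fun w => ?_)).mpr h
  change (0 = w none) ↔ _ = _
  omega

/-- The number `1` is definable as the least nonzero number. -/
theorem buchi_definableFun_one :
    (∅ : Set ℕ).DefinableFun (buchi n) fun _ : α → ℕ => 1 := by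
  have h : (∅ : Set ℕ).Definable (buchi n)
      {w : Option α → ℕ | ∀ x, w none ≤ x ↔ ¬ x = 0} := by
    simp_rw [iff_iff_implies_and_implies]
    refine definable_forall (P := fun w x => (w none ≤ x → ¬ x = 0) ∧ (¬ x = 0 → w none ≤ x)) ?_
    have h1 : (∅ : Set ℕ).Definable (buchi n)
        {w : Option (Option α) → ℕ | w (some none) ≤ w none} :=
      buchi_definable_le (.proj _) (.proj _)
    have h2 : (∅ : Set ℕ).Definable (buchi n) {w : Option (Option α) → ℕ | ¬ w none = 0} :=
      (Set.DefinableFun.ofPred_eq (.proj _) buchi_definableFun_zero).compl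
    exact definable_and (definable_imp h1 h2) (definable_imp h2 h1)
  refine (congrArg ((∅ : Set ℕ).Definable (buchi n)) (Set.ext fun w => ?_)).mpr h
  change (1 = w none) ↔ ∀ x, w none ≤ x ↔ ¬ x = 0
  refine ⟨fun h x => by omega, fun h => ?_⟩
  have h0 := h 0
  have h1 := h 1
  omega

theorem buchi_definableFun_const_mul (c : ℕ) {f : (α → ℕ) → ℕ}
    (hf : (∅ : Set ℕ).DefinableFun (buchi n) f) :
    (∅ : Set ℕ).DefinableFun (buchi n) fun v => c * f v := by
  induction c with
  | zero => simpa using! buchi_definableFun_zero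
  | succ c ih => simpa [add_mul] using! buchi_definableFun_add ih hf

theorem buchi_definableFun_sum {ι : Type*} (s : Finset ι) {f : ι → (α → ℕ) → ℕ}
    (hf : ∀ i, (∅ : Set ℕ).DefinableFun (buchi n) (f i)) :
    (∅ : Set ℕ).DefinableFun (buchi n) fun v => ∑ i ∈ s, f i v := by
  classical
  induction s using Finset.induction_on with
  | empty => simpa using! buchi_definableFun_zero
  | insert i s hi ih => simpa [Finset.sum_insert hi] using! buchi_definableFun_add (hf i) ih

end Definability

/-! ### The function `V_n` -/

theorem buchiV_eq_pow {n x : ℕ} (hx : x ≠ 0) : buchiV n x = n ^ multiplicity n x := if_neg hx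

theorem buchiV_eq_pow_of_dvd {n x k : ℕ} (hx : x ≠ 0) (h : n ^ k ∣ x) (h' : ¬ n ^ (k + 1) ∣ x) :
    buchiV n x = n ^ k := by
  rw [buchiV_eq_pow hx, multiplicity_eq_of_dvd_of_not_dvd h h']

theorem buchiV_of_not_dvd {n x : ℕ} (h : ¬ n ∣ x) : buchiV n x = 1 := by
  have hx : x ≠ 0 := by rintro rfl; simp at h
  simpa using buchiV_eq_pow_of_dvd (k := 0) hx (by simp) (by simpa using h)

theorem buchiV_pow_mul {n : ℕ} (hn : 2 ≤ n) (m x : ℕ) :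
    buchiV n (n ^ m * x) = n ^ m * buchiV n x := by
  by_cases hx : x = 0
  · simp [hx, buchiV_zero]
  have hp : 0 < n ^ m := Nat.pow_pos (by omega)
  have hfin : FiniteMultiplicity n x :=
    Nat.finiteMultiplicity_iff.2 ⟨by omega, Nat.pos_of_ne_zero hx⟩
  rw [buchiV_eq_pow hx, ← pow_add]
  refine buchiV_eq_pow_of_dvd (by positivity) ?_ ?_
  · rw [pow_add]
    exact mul_dvd_mul_left _ (pow_multiplicity_dvd n x)
  · rw [add_assoc, pow_add]
    exact fun h => hfin.not_pow_dvd_of_multiplicity_lt (Nat.lt_succ_self _)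
      (Nat.dvd_of_mul_dvd_mul_left hp h)

/-- The powers of `n ^ m` can be singled out among the powers of `n` by a congruence. -/
theorem pow_modEq_one_iff {n : ℕ} (hn : 2 ≤ n) (m k : ℕ) :
    n ^ k ≡ 1 [MOD n ^ m - 1] ↔ m ∣ k := by
  have h1 : ∀ j, 1 ≤ n ^ j := fun j => Nat.one_le_pow _ _ (by omega)
  rw [Nat.ModEq.comm, Nat.modEq_iff_dvd' (h1 k)]
  refine ⟨fun h => ?_, fun h => Nat.pow_sub_one_dvd_pow_sub_one _ h⟩
  have h0 := Nat.mod_eq_zero_of_dvd h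
  rw [Nat.pow_sub_one_mod_pow_sub_one] at h0
  have h2 : n ^ (k % m) = n ^ 0 := by have := h1 (k % m); rw [pow_zero]; omega
  exact Nat.dvd_of_mod_eq_zero (Nat.pow_right_injective hn h2)

/-! ### Spreading the digits of a number -/

/-- `spread n m a` is obtained from `a` by putting `m - 1` zeros in front of each digit of its
base-`n` expansion: the digit of `a` at position `i` becomes the digit at position `m * i`. -/
def spread (n m a : ℕ) : ℕ := Nat.ofDigits (n ^ m) (Nat.digits n a)

section Spread

variable {n m : ℕ}

theorem spread_zero : spread n m 0 = 0 := by simp [spread]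

theorem spread_add_mul (hn : 2 ≤ n) {d : ℕ} (hd : d < n) (a : ℕ) :
    spread n m (d + n * a) = d + n ^ m * spread n m a := by
  by_cases h : d ≠ 0 ∨ a ≠ 0
  · rw [spread, Nat.digits_add n (by omega) d a hd h, Nat.ofDigits_cons]
    rfl
  · push Not at h
    simp [h.1, h.2, spread_zero]

theorem spread_eq (hn : 2 ≤ n) (a : ℕ) :
    spread n m a = a % n + n ^ m * spread n m (a / n) := by
  conv_lhs => rw [← Nat.mod_add_div a n]
  exact spread_add_mul hn (Nat.mod_lt _ (by omega)) _

theorem spread_of_lt (hn : 2 ≤ n) {d : ℕ} (hd : d < n) : spread n m d = d := by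
  simpa [spread_zero] using spread_add_mul (m := m) hn hd 0

theorem spread_mod (hn : 2 ≤ n) (hm : m ≠ 0) (a : ℕ) : spread n m a % n ^ m = a % n := by
  rw [spread_eq hn, Nat.add_mul_mod_self_left, Nat.mod_eq_of_lt]
  exact (Nat.mod_lt _ (by omega)).trans_le (Nat.le_self_pow hm n)

theorem spread_div (hn : 2 ≤ n) (hm : m ≠ 0) (a : ℕ) :
    spread n m a / n ^ m = spread n m (a / n) := by
  rw [spread_eq hn, Nat.add_mul_div_left _ _ (Nat.pow_pos (by omega)), Nat.div_eq_of_lt, zero_add]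
  exact (Nat.mod_lt _ (by omega)).trans_le (Nat.le_self_pow hm n)

theorem spread_injective (hn : 2 ≤ n) (hm : m ≠ 0) : Function.Injective (spread n m) := by
  have key : ∀ s a b, a + b = s → spread n m a = spread n m b → a = b := by
    intro s
    induction s using Nat.strong_induction_on with
    | _ s ih =>
      intro a b hs h
      rcases Nat.eq_zero_or_pos s with h0 | h0
      · omega
      have h1 : a % n = b % n := by rw [← spread_mod hn hm, h, spread_mod hn hm]
      have h2 : spread n m (a / n) = spread n m (b / n) := by
        rw [← spread_div hn hm, h, spread_div hn hm]
      have h3 : ∀ x, x / n ≤ x := fun x => Nat.div_le_self x n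
      have h4 : ∀ x, 0 < x → x / n < x := fun x hx => Nat.div_lt_self hx (by omega)
      have := h3 a; have := h3 b; have := h4 a; have := h4 b
      have h5 := ih (a / n + b / n) (by omega) _ _ rfl h2
      rw [← Nat.mod_add_div a n, ← Nat.mod_add_div b n, h1, h5]
  exact fun a b => key _ a b rfl

theorem buchiV_spread (hn : 2 ≤ n) (hm : m ≠ 0) (a : ℕ) :
    buchiV n (spread n m a) = spread n m (buchiV n a) := by
  induction a using Nat.strong_induction_on with
  | _ a ih =>
    rcases Nat.eq_zero_or_pos a with rfl | ha
    · simp [spread_zero, buchiV_zero]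
    by_cases h : n ∣ a
    · obtain ⟨b, rfl⟩ := h
      have hb : b < n * b := by
        have : 0 < b := Nat.pos_of_mul_pos_left ha
        nlinarith
      have h1 : ∀ x, spread n m (n * x) = n ^ m * spread n m x := fun x => by
        simpa using spread_add_mul (m := m) hn (show 0 < n by omega) x
      have h2 := buchiV_pow_mul hn 1 b
      rw [pow_one] at h2
      rw [h1, h2, h1, buchiV_pow_mul hn, ih b hb]
    · rw [buchiV_of_not_dvd h, spread_of_lt hn (show 1 < n by omega), buchiV_of_not_dvd]
      rwa [Nat.dvd_iff_mod_eq_zero, ← Nat.mod_mod_of_dvd _ (dvd_pow_self n hm), spread_mod hn hm,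
        Nat.mod_mod, ← Nat.dvd_iff_mod_eq_zero]

/-- The numbers all of whose nonzero base-`n` digits stand at multiples of `m` are the numbers
`x` such that, whenever `x = r + y` cuts `x` in front of a nonzero digit, which is what
`r < V_n y` says, the position of that digit is a multiple of `m`. -/
theorem mem_range_spread_iff (hn : 2 ≤ n) (hm : m ≠ 0) (x : ℕ) :
    x ∈ Set.range (spread n m) ↔
      ∀ r y, x = r + y → r < buchiV n y → buchiV n y ≡ 1 [MOD n ^ m - 1] := by
  have hN : 0 < n ^ m := Nat.pow_pos (by omega)
  have hnN : n ≤ n ^ m := Nat.le_self_pow hm n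
  have hV0 : ∀ {r y}, r < buchiV n y → y ≠ 0 := by
    rintro r _ h rfl
    simp [buchiV_zero] at h
  constructor
  · rintro ⟨a, rfl⟩
    induction a using Nat.strong_induction_on with
    | _ a ih =>
      intro r y h hr
      have hy := hV0 hr
      rw [buchiV_eq_pow hy] at hr ⊢
      rw [pow_modEq_one_iff hn]
      have hdvd := pow_multiplicity_dvd n y
      have hfin : FiniteMultiplicity n y :=
        Nat.finiteMultiplicity_iff.2 ⟨by omega, Nat.pos_of_ne_zero hy⟩
      set j := multiplicity n y with hj
      have ha : 0 < a := by
        rcases Nat.eq_zero_or_pos a with rfl | h0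
        · rw [spread_zero] at h; omega
        · exact h0
      rcases Nat.eq_zero_or_pos j with h0 | h0
      · simp [h0]
      have hny : n ∣ y := (dvd_pow_self n h0.ne').trans hdvd
      -- the last digit of `x` is that of `r`
      have hrn : r % n = a % n := by
        have h1 := spread_mod hn hm a
        have h2 := Nat.mod_mod_of_dvd (spread n m a) (dvd_pow_self n hm)
        rw [h1, Nat.mod_mod, h] at h2
        rw [h2, Nat.add_mod, Nat.mod_eq_zero_of_dvd hny, add_zero, Nat.mod_mod]
      have hsp := spread_eq (m := m) hn a
      by_cases hjm : j < m
      · exfalso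
        have hle : a % n ≤ r := by rw [← hrn]; exact Nat.mod_le _ _
        have h3 : n ^ m * spread n m (a / n) = (r - a % n) + y := by omega
        have h4 : n ^ j ∣ (r - a % n) + y := h3 ▸ (pow_dvd_pow n hjm.le).mul_right _
        have h5 : n ^ j ∣ r - a % n := (Nat.dvd_add_left hdvd).1 h4
        have h6 : r - a % n = 0 := Nat.eq_zero_of_dvd_of_lt h5 (by omega)
        rw [h6, zero_add] at h3
        refine hfin.not_pow_dvd_of_multiplicity_lt (hj ▸ hjm) ⟨_, h3.symm⟩
      · push Not at hjm
        obtain ⟨y', rfl⟩ := (pow_dvd_pow n hjm).trans hdvd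
        have hy' : y' ≠ 0 := by rintro rfl; simp at hy
        have hV := buchiV_pow_mul hn m y'
        rw [buchiV_eq_pow hy, buchiV_eq_pow hy', ← hj] at hV
        have h3 : r % n ^ m = a % n := by
          rw [← spread_mod hn hm a, h, Nat.add_mul_mod_self_left]
        have h4 : spread n m (a / n) = r / n ^ m + y' := by
          rw [← spread_div hn hm, h, Nat.add_mul_div_left _ _ hN]
        have h5 : r / n ^ m < buchiV n y' := by
          rw [buchiV_eq_pow hy', Nat.div_lt_iff_lt_mul hN, mul_comm, ← hV]
          exact hr
        have h6 := ih _ (Nat.div_lt_self ha (by omega)) _ _ h4 h5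
        rw [buchiV_eq_pow hy', pow_modEq_one_iff hn] at h6
        rw [← pow_add] at hV
        rw [Nat.pow_right_injective hn hV]
        exact dvd_add (dvd_refl m) h6
  · induction x using Nat.strong_induction_on with
    | _ x ih =>
      intro h
      rcases Nat.eq_zero_or_pos x with rfl | hx
      · exact ⟨0, spread_zero⟩
      have hlt : x % n < n := Nat.mod_lt _ (by omega)
      have hdvd : n ^ m ∣ n * (x / n) := by
        by_cases hy : n * (x / n) = 0
        · rw [hy]; exact dvd_zero _
        have hfin : FiniteMultiplicity n (n * (x / n)) :=
          Nat.finiteMultiplicity_iff.2 ⟨by omega, Nat.pos_of_ne_zero hy⟩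
        have hj : 1 ≤ multiplicity n (n * (x / n)) :=
          hfin.le_multiplicity_of_pow_dvd (by simp)
        have h1 := h _ _ (Nat.mod_add_div x n).symm (by
          rw [buchiV_eq_pow hy]
          exact hlt.trans_le (Nat.le_self_pow (by omega) n))
        rw [buchiV_eq_pow hy, pow_modEq_one_iff hn] at h1
        exact (pow_dvd_pow n (Nat.le_of_dvd hj h1)).trans (pow_multiplicity_dvd _ _)
      obtain ⟨z, hz⟩ := hdvd
      have hxz : x = x % n + n ^ m * z := by rw [← hz, Nat.mod_add_div]
      have hzx : z < x := by
        rcases Nat.eq_zero_or_pos z with rfl | hz0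
        · exact hx
        · have : 2 * z ≤ n ^ m * z := Nat.mul_le_mul_right z (hn.trans hnN)
          omega
      obtain ⟨a, ha⟩ := ih z hzx (by
        intro r y hry hr
        have hy := hV0 hr
        have h1 := h (x % n + n ^ m * r) (n ^ m * y) (by rw [add_assoc, ← mul_add, ← hry, ← hxz])
          (by rw [buchiV_pow_mul hn]; nlinarith)
        rw [buchiV_pow_mul hn, buchiV_eq_pow hy, ← pow_add, pow_modEq_one_iff hn] at h1
        rw [buchiV_eq_pow hy, pow_modEq_one_iff hn]
        exact (Nat.dvd_add_right (dvd_refl m)).1 h1)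
      exact ⟨x % n + n * a, by rw [spread_add_mul hn hlt, ha, ← hxz]⟩

/-- The number `k` is the carry word of the addition `a + b + t`: its digit at position `i` is the
carry out of position `i`. -/
theorem exists_spread_add (hn : 2 ≤ n) (a b t : ℕ) (ht : t ≤ 1) :
    ∃ k, spread n m a + spread n m b + t + n ^ m * spread n m k =
      spread n m (a + b + t) + n * spread n m k := by
  induction h : a + b using Nat.strong_induction_on generalizing a b t with
  | _ s ih =>
    rcases Nat.eq_zero_or_pos s with rfl | hs
    · obtain ⟨rfl, rfl⟩ : a = 0 ∧ b = 0 := by omega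
      exact ⟨0, by simp [spread_zero, spread_of_lt hn (show t < n by omega)]⟩
    have ha := Nat.mod_add_div a n
    have hb := Nat.mod_add_div b n
    have ha' : a % n < n := Nat.mod_lt _ (by omega)
    have hb' : b % n < n := Nat.mod_lt _ (by omega)
    have hdec : a / n + b / n < s := by
      rcases Nat.eq_zero_or_pos a with rfl | h0
      · have := Nat.div_lt_self (show 0 < b by omega) (show 1 < n by omega)
        simp; omega
      · have := Nat.div_lt_self h0 (show 1 < n by omega)
        have := Nat.div_le_self b n
        omega
    obtain ⟨c, t', hc, ht', hct⟩ : ∃ c t', c < n ∧ t' ≤ 1 ∧ a % n + b % n + t = c + n * t' := by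
      by_cases h1 : a % n + b % n + t < n
      · exact ⟨_, 0, h1, by omega, by simp⟩
      · exact ⟨a % n + b % n + t - n, 1, by omega, le_rfl, by omega⟩
    obtain ⟨k, hk⟩ := ih _ hdec (a / n) (b / n) t' ht' rfl
    refine ⟨t' + n * k, ?_⟩
    have hsum : a + b + t = c + n * (a / n + b / n + t') := by
      rw [mul_add, mul_add]; omega
    rw [← h, hsum, spread_add_mul hn hc, spread_add_mul hn (show t' < n by omega),
      spread_eq hn a, spread_eq hn b]
    linear_combination n ^ m * hk + hct

/-- The digits of `k` are not assumed to be `0` or `1`: since `2 ≤ m`, the equation modulo `n ^ m`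
forces the last digit of `k` to be the carry, and it can then be divided by `n ^ m`. -/
theorem eq_add_of_spread_add (hn : 2 ≤ n) (hm : 2 ≤ m) (a b c k t : ℕ) (ht : t ≤ 1)
    (h : spread n m a + spread n m b + t + n ^ m * spread n m k =
      spread n m c + n * spread n m k) : c = a + b + t := by
  have hm0 : m ≠ 0 := by omega
  induction hs : a + b + c + k using Nat.strong_induction_on generalizing a b c k t with
  | _ s ih =>
    have hN : 0 < n ^ m := Nat.pow_pos (by omega)
    rcases Nat.eq_zero_or_pos s with rfl | hs0
    · obtain ⟨rfl, rfl, rfl, rfl⟩ : a = 0 ∧ b = 0 ∧ c = 0 ∧ k = 0 := by omega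
      simp [spread_zero] at h
      omega
    have hdec : a / n + b / n + c / n + k / n < s := by
      have h1 : ∀ x, x / n ≤ x := fun x => Nat.div_le_self x n
      have h2 : ∀ x, 0 < x → x / n < x := fun x hx => Nat.div_lt_self hx (by omega)
      have := h1 a; have := h1 b; have := h1 c; have := h1 k
      have := h2 a; have := h2 b; have := h2 c; have := h2 k
      omega
    have ha := Nat.mod_add_div a n
    have hb := Nat.mod_add_div b n
    have hc := Nat.mod_add_div c n
    have hlt : ∀ x, x % n < n := fun x => Nat.mod_lt _ (by omega)
    have ha' := hlt a
    have hb' := hlt b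
    have hc' := hlt c
    have hk' := hlt k
    rw [spread_eq hn a, spread_eq hn b, spread_eq hn c, spread_eq hn k] at h
    -- modulo `n ^ m` the equation says that the last digit of `k` is the carry
    have h1 : a % n + b % n + t = c % n + n * (k % n) := by
      have hmod : a % n + b % n + t ≡ c % n + n * (k % n) [MOD n ^ m] := by
        have := congrArg (· % n ^ m) h
        have e1 : a % n + n ^ m * spread n m (a / n) + (b % n + n ^ m * spread n m (b / n)) + t +
            n ^ m * (k % n + n ^ m * spread n m (k / n)) = a % n + b % n + t +
            n ^ m * (spread n m (a / n) + spread n m (b / n) +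
              (k % n + n ^ m * spread n m (k / n))) := by ring
        have e2 : c % n + n ^ m * spread n m (c / n) + n * (k % n + n ^ m * spread n m (k / n)) =
            c % n + n * (k % n) + n ^ m * (spread n m (c / n) + n * spread n m (k / n)) := by ring
        rw [e1, e2, Nat.add_mul_mod_self_left, Nat.add_mul_mod_self_left] at this
        exact this
      have hsq : n * n ≤ n ^ m := by
        rw [← pow_two]; exact Nat.pow_le_pow_right (by omega) hm
      refine Nat.ModEq.eq_of_lt_of_lt hmod ?_ ?_
      · have : 2 * n ≤ n * n := Nat.mul_le_mul_right n hn
        omega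
      · have : n * (k % n + 1) ≤ n * n := Nat.mul_le_mul_left n hk'
        rw [mul_add] at this
        omega
    have hk1 : k % n ≤ 1 := by
      by_contra hlt2
      have : n * 2 ≤ n * (k % n) := Nat.mul_le_mul_left n (by omega)
      omega
    have h2 : spread n m (a / n) + spread n m (b / n) + k % n + n ^ m * spread n m (k / n) =
        spread n m (c / n) + n * spread n m (k / n) := by
      refine Nat.eq_of_mul_eq_mul_left hN ?_
      zify at h h1 ⊢
      linear_combination h - h1
    have h3 := ih _ hdec (a / n) (b / n) (c / n) (k / n) (k % n) hk1 h2 rfl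
    rw [h3, mul_add, mul_add] at hc
    omega

/-- Addition, carried along `spread`, is definable from addition: `k` is the carry word. -/
theorem eq_add_iff_spread (hn : 2 ≤ n) (hm : 2 ≤ m) (a b c : ℕ) :
    c = a + b ↔ ∃ k, spread n m a + spread n m b + n ^ m * spread n m k =
      spread n m c + n * spread n m k := by
  refine ⟨?_, fun ⟨k, hk⟩ => eq_add_of_spread_add hn hm a b c k 0 (by omega) hk⟩
  rintro rfl
  exact exists_spread_add hn a b 0 (by omega)

/-! ### Interleaving the digits of a tuple -/

/-- `interleave n m a` is the number whose base-`n` digits are those of the numbers `a i`, taken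
alternately: the digit of `a i` at position `p` becomes the digit at position `m * p + i`. -/
def interleave (n m : ℕ) (a : Fin m → ℕ) : ℕ := ∑ i : Fin m, n ^ (i : ℕ) * spread n m (a i)

theorem interleave_eq (hn : 2 ≤ n) (a : Fin m → ℕ) :
    interleave n m a =
      ∑ i : Fin m, (a i % n) * n ^ (i : ℕ) + n ^ m * interleave n m (fun i => a i / n) := by
  unfold interleave
  rw [Finset.mul_sum, ← Finset.sum_add_distrib]
  refine Finset.sum_congr rfl fun i _ => ?_
  rw [spread_eq hn (a i)]
  ring

theorem interleave_injective (hn : 2 ≤ n) : Function.Injective (interleave n m) := by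
  have hN : 0 < n ^ m := Nat.pow_pos (by omega)
  have key : ∀ s (a b : Fin m → ℕ), (∑ i, (a i + b i) = s) →
      interleave n m a = interleave n m b → a = b := by
    intro s
    induction s using Nat.strong_induction_on with
    | _ s ih =>
      intro a b hs h
      by_cases h0 : ∀ i, a i + b i = 0
      · funext i
        have := h0 i
        omega
      push Not at h0
      obtain ⟨i₀, hi₀⟩ := h0
      let d : (Fin m → ℕ) → Fin m → Fin n := fun a i => ⟨a i % n, Nat.mod_lt _ (by omega)⟩
      have hd : ∀ a, ∑ i : Fin m, (a i % n) * n ^ (i : ℕ) = (finFunctionFinEquiv (d a) : ℕ) := fun a => by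
        simp [d]
      rw [interleave_eq hn a, interleave_eq hn b, hd, hd] at h
      have hmod := congrArg (· % n ^ m) h
      have hdiv := congrArg (· / n ^ m) h
      simp only [Nat.add_mul_mod_self_left, Nat.mod_eq_of_lt (Fin.is_lt _)] at hmod
      simp only [Nat.add_mul_div_left _ _ hN, Nat.div_eq_of_lt (Fin.is_lt _), zero_add] at hdiv
      have hdd : d a = d b := finFunctionFinEquiv.injective (Fin.ext hmod)
      have hq := ih (∑ i, (a i / n + b i / n)) (by
        rw [← hs]
        refine Finset.sum_lt_sum (fun i _ => ?_) ⟨i₀, Finset.mem_univ _, ?_⟩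
        · exact Nat.add_le_add (Nat.div_le_self _ _) (Nat.div_le_self _ _)
        · have h1 : ∀ x, x / n ≤ x := fun x => Nat.div_le_self x n
          have h2 : ∀ x, 0 < x → x / n < x := fun x hx => Nat.div_lt_self hx (by omega)
          have := h1 (a i₀); have := h1 (b i₀)
          have := h2 (a i₀); have := h2 (b i₀)
          omega) _ _ rfl hdiv
      funext i
      have h1 : a i % n = b i % n := congrArg Fin.val (congrFun hdd i)
      have h2 : a i / n = b i / n := congrFun hq i
      rw [← Nat.mod_add_div (a i) n, ← Nat.mod_add_div (b i) n, h1, h2]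
  exact fun a b => key _ a b rfl

end Spread

/-! ### The spread copy of Büchi arithmetic inside itself -/

section Translation

variable {n m : ℕ} {α : Type*}

theorem buchi_definable_modEq_one (c : ℕ) {f : (α → ℕ) → ℕ}
    (hf : (∅ : Set ℕ).DefinableFun (buchi n) f) :
    (∅ : Set ℕ).Definable (buchi n) {v | f v ≡ 1 [MOD c]} := by
  have h : ∀ x : ℕ, x ≡ 1 [MOD c] ↔ ∃ u w, x + c * u = 1 + c * w := fun x => by
    refine ⟨fun h => ⟨1 / c, x / c, ?_⟩, fun ⟨u, w, h⟩ => ?_⟩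
    · have h1 := Nat.mod_add_div x c
      have h2 := Nat.mod_add_div 1 c
      have h3 : x % c = 1 % c := h
      omega
    · have h1 := congrArg (· % c) h
      simp only [Nat.add_mul_mod_self_left] at h1
      exact h1
  simp_rw [h]
  refine definable_exists (P := fun v u => ∃ w, f v + c * u = 1 + c * w)
    (definable_exists
      (P := fun (v : Option α → ℕ) w => f (v ∘ some) + c * v none = 1 + c * w) ?_)
  exact Set.DefinableFun.ofPred_eq
    (buchi_definableFun_add (definableFun_weaken (definableFun_weaken hf))
      (buchi_definableFun_const_mul c (.proj _ (i := some none))))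
    (buchi_definableFun_add buchi_definableFun_one
      (buchi_definableFun_const_mul c (.proj _)))

theorem buchi_definable_range_spread (hn : 2 ≤ n) (hm : m ≠ 0) :
    (∅ : Set ℕ).Definable₁ (buchi n) (Set.range (spread n m)) := by
  have h : (∅ : Set ℕ).Definable (buchi n) {v : Fin 1 → ℕ | ∀ r y, v 0 = r + y →
      r < buchiV n y → buchiV n y ≡ 1 [MOD n ^ m - 1]} := by
    refine definable_forall (P := fun v r => ∀ y, v 0 = r + y →
        r < buchiV n y → buchiV n y ≡ 1 [MOD n ^ m - 1])
      (definable_forall (P := fun (v : Option (Fin 1) → ℕ) y => v (some 0) = v none + y →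
        v none < buchiV n y → buchiV n y ≡ 1 [MOD n ^ m - 1]) ?_)
    have hV : (∅ : Set ℕ).DefinableFun (buchi n)
        fun v : Option (Option (Fin 1)) → ℕ => buchiV n (v none) :=
      buchi_definableFun_V (.proj _)
    refine definable_imp ?_ (definable_imp ?_ (buchi_definable_modEq_one _ hV))
    · exact Set.DefinableFun.ofPred_eq (.proj _ (i := some (some 0)))
        (buchi_definableFun_add (.proj _ (i := some none)) (.proj _))
    · exact buchi_definable_le
        (buchi_definableFun_add (.proj _ (i := some none)) buchi_definableFun_one) hV
  simp_rw [← mem_range_spread_iff hn hm] at h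
  exact h

/-- Addition carried along `spread` extends to a definable operation on all numbers. -/
theorem exists_definableFun_spread_add (hn : 2 ≤ n) (hm : 2 ≤ m) :
    ∃ f : (Fin 2 → ℕ) → ℕ, (∅ : Set ℕ).DefinableFun (buchi n) f ∧
      ∀ a b, f ![spread n m a, spread n m b] = spread n m (a + b) := by
  classical
  have hinj := spread_injective (n := n) (m := m) hn (by omega)
  have hS := buchi_definable_range_spread (n := n) (m := m) hn (by omega)
  -- arguments outside the range of `spread` count as `0`
  let p : ℕ → ℕ := fun x => if x ∈ Set.range (spread n m) then x else 0
  have hp : ∀ (β : Type) (i : β), (∅ : Set ℕ).DefinableFun (buchi n) fun v : β → ℕ => p (v i) :=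
    fun β i => Set.DefinableFun.ite (definable_pred hS (.proj _)) (.proj _) buchi_definableFun_zero
  have hpr : ∀ a, p (spread n m a) = spread n m a := fun a => if_pos ⟨a, rfl⟩
  have hpx : ∀ x, ∃ a, p x = spread n m a := fun x => by
    by_cases hx : x ∈ Set.range (spread n m)
    · exact ⟨hx.choose, by rw [hx.choose_spec]; exact if_pos hx⟩
    · exact ⟨0, by rw [spread_zero]; exact if_neg hx⟩
  let q : ℕ → ℕ := fun x => (hpx x).choose
  have hq : ∀ x, p x = spread n m (q x) := fun x => (hpx x).choose_spec
  have hqs : ∀ a, q (spread n m a) = a := fun a => hinj (by rw [← hq, hpr])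
  refine ⟨fun v => spread n m (q (v 0) + q (v 1)), ?_, fun a b => by simp [hqs]⟩
  have key : (∅ : Set ℕ).Definable (buchi n) {w : Option (Fin 2) → ℕ |
      w none ∈ Set.range (spread n m) ∧ ∃ k, k ∈ Set.range (spread n m) ∧
        p (w (some 0)) + p (w (some 1)) + n ^ m * k = w none + n * k} := by
    refine definable_and (definable_pred hS (.proj _)) (definable_exists
      (P := fun (w : Option (Fin 2) → ℕ) k => k ∈ Set.range (spread n m) ∧
        p (w (some 0)) + p (w (some 1)) + n ^ m * k = w none + n * k)
      (definable_and (definable_pred hS (.proj _)) ?_))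
    exact Set.DefinableFun.ofPred_eq
      (buchi_definableFun_add (buchi_definableFun_add (hp _ (some (some 0)))
        (hp _ (some (some 1)))) (buchi_definableFun_const_mul _ (.proj _)))
      (buchi_definableFun_add (.proj _ (i := some none)) (buchi_definableFun_const_mul _ (.proj _)))
  refine (congrArg ((∅ : Set ℕ).Definable (buchi n)) (Set.ext fun w => ?_)).mpr key
  change spread n m (q (w (some 0)) + q (w (some 1))) = w none ↔ w none ∈ Set.range (spread n m) ∧
    ∃ k, k ∈ Set.range (spread n m) ∧ p (w (some 0)) + p (w (some 1)) + n ^ m * k = w none + n * k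
  rw [hq, hq]
  constructor
  · intro h
    rw [← h]
    obtain ⟨k, hk⟩ := (eq_add_iff_spread hn hm (q (w (some 0))) (q (w (some 1))) _).1 rfl
    exact ⟨⟨_, rfl⟩, _, ⟨k, rfl⟩, hk⟩
  · rintro ⟨⟨c, hc⟩, _, ⟨k, rfl⟩, hk⟩
    rw [← hc] at hk ⊢
    rw [← (eq_add_iff_spread hn hm _ _ _).2 ⟨k, hk⟩]

theorem exists_definableFun_spread_term (hn : 2 ≤ n) (hm : 2 ≤ m) (t : (buchi n).Term α) :
    ∃ f : (α → ℕ) → ℕ, (∅ : Set ℕ).DefinableFun (buchi n) f ∧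
      ∀ v : α → ℕ, f (spread n m ∘ v) = spread n m (t.realize v) := by
  induction t with
  | var i => exact ⟨fun v => v i, .proj _, fun v => rfl⟩
  | func g ts ih =>
    choose f hf hfe using ih
    cases g with
    | add =>
      obtain ⟨p, hp, hpe⟩ := exists_definableFun_spread_add hn hm
      refine ⟨fun v => p ![f 0 v, f 1 v], Set.DefinableFun.comp
        (g := fun v => ![f 0 v, f 1 v]) (by intro i; fin_cases i <;> exact hf _) hp, fun v => ?_⟩
      change p ![f 0 (spread n m ∘ v), f 1 (spread n m ∘ v)] =
        spread n m ((ts 0).realize v + (ts 1).realize v)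
      rw [hfe, hfe, hpe]
    | V =>
      refine ⟨fun v => buchiV n (f 0 v), buchi_definableFun_V (hf 0), fun v => ?_⟩
      change buchiV n (f 0 (spread n m ∘ v)) = spread n m (buchiV n ((ts 0).realize v))
      rw [hfe, buchiV_spread hn (by omega)]

/-- `spread` is an isomorphism of Büchi arithmetic onto a structure definable in Büchi
arithmetic, so that every formula has a translation which says the same of the spread numbers:
relativize the quantifiers to the range of `spread` and replace the operations. -/
theorem exists_spread_translation (hn : 2 ≤ n) (hm : 2 ≤ m) {k : ℕ}
    (φ : (buchi n).BoundedFormula α k) :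
    ∃ ψ : (buchi n).BoundedFormula α k, ∀ (v : α → ℕ) (xs : Fin k → ℕ),
      ψ.Realize (spread n m ∘ v) (spread n m ∘ xs) ↔ φ.Realize v xs := by
  induction φ with
  | falsum => exact ⟨⊥, fun _ _ => Iff.rfl⟩
  | @equal k t₁ t₂ =>
    obtain ⟨f₁, hf₁, h₁⟩ := exists_definableFun_spread_term hn hm t₁
    obtain ⟨f₂, hf₂, h₂⟩ := exists_definableFun_spread_term hn hm t₂
    obtain ⟨ψ, hψ⟩ := Set.empty_definable_iff.1 (hf₁.ofPred_eq hf₂)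
    refine ⟨BoundedFormula.relabel (n := k) (k := 0) id ψ, fun v xs => ?_⟩
    have h := Set.ext_iff.1 hψ (spread n m ∘ Sum.elim v xs)
    simp only [Set.mem_ofPred_eq] at h
    rw [h₁, h₂, (spread_injective hn (by omega)).eq_iff] at h
    rw [BoundedFormula.realize_relabel]
    refine Iff.trans (Eq.to_iff ?_) h.symm
    change BoundedFormula.Realize _ _ _ = BoundedFormula.Realize _ _ _
    congr 1
    · rw [Sum.comp_elim]
      rfl
    · exact Subsingleton.elim _ _
  | rel R => exact nomatch R
  | imp _ _ ih₁ ih₂ =>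
    obtain ⟨ψ₁, h₁⟩ := ih₁
    obtain ⟨ψ₂, h₂⟩ := ih₂
    exact ⟨ψ₁.imp ψ₂, fun v xs => by
      rw [BoundedFormula.realize_imp, BoundedFormula.realize_imp, h₁, h₂]⟩
  | @all k φ ih =>
    obtain ⟨ψ, h⟩ := ih
    obtain ⟨σ, hσ⟩ := Set.empty_definable_iff.1
      (buchi_definable_range_spread (n := n) (m := m) hn (by omega))
    have hσ' : ∀ v, σ.Realize v ↔ v 0 ∈ Set.range (spread n m) := fun v =>
      (Set.ext_iff.1 hσ v).symm
    let σ' : (buchi n).BoundedFormula α (k + 1) :=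
      BoundedFormula.relabel (n := k + 1) (k := 0) (fun _ => Sum.inr (Fin.last k)) σ
    have hσ'' : ∀ v xs x, σ'.Realize v (Fin.snoc xs x) ↔ x ∈ Set.range (spread n m) :=
      fun v xs x => by
        rw [BoundedFormula.realize_relabel]
        refine Iff.trans (Eq.to_iff ?_) ((hσ' fun _ => x))
        change BoundedFormula.Realize _ _ _ = BoundedFormula.Realize _ _ _
        congr 1
        · funext i
          simp
        · exact Subsingleton.elim _ _
    refine ⟨(σ'.imp ψ).all, fun v xs => ?_⟩
    simp only [BoundedFormula.realize_all, BoundedFormula.realize_imp, hσ'', Set.forall_mem_range]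
    refine forall_congr' fun a => ?_
    rw [← h v (Fin.snoc xs a), Fin.comp_snoc]

/-- The image of a definable relation between `m`-tuples under `interleave` is definable. -/
theorem exists_interleave_translation (hn : 2 ≤ n) (hm : 2 ≤ m) (γ : Type) [Finite γ]
    (φ : (buchi n).Formula (γ × Fin m)) :
    ∃ ψ : (buchi n).Formula (γ × Fin 1), ∀ w : γ → Fin 1 → ℕ,
      ψ.Realize (Function.uncurry w) ↔
        ∃ v : γ → Fin m → ℕ, (∀ i, w i = fun _ => interleave n m (v i)) ∧
          φ.Realize (Function.uncurry v) := by
  obtain ⟨φ', hφ'⟩ := exists_spread_translation hn hm φ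
  have hφ'' : ∀ v, Formula.Realize φ' (spread n m ∘ v) ↔ φ.Realize v := fun v => by
    rw [Formula.Realize, Formula.Realize, ← hφ']
    exact Eq.to_iff (congrArg _ (Subsingleton.elim _ _))
  have hS := buchi_definable_range_spread (n := n) (m := m) hn (by omega)
  have key : (∅ : Set ℕ).Definable (buchi n) {w : γ × Fin 1 → ℕ | ∃ s : γ × Fin m → ℕ,
      (∀ p, s p ∈ Set.range (spread n m)) ∧ (∀ i, w (i, 0) = ∑ j : Fin m, n ^ (j : ℕ) * s (i, j)) ∧
        Formula.Realize φ' s} := by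
    refine Set.Definable.exists_of_finite (S := {u : (γ × Fin 1) ⊕ (γ × Fin m) → ℕ |
      (∀ p, u (.inr p) ∈ Set.range (spread n m)) ∧
      (∀ i, u (.inl (i, 0)) = ∑ j : Fin m, n ^ (j : ℕ) * u (.inr (i, j))) ∧
        Formula.Realize φ' (u ∘ Sum.inr)}) (definable_and ?_ (definable_and ?_ ?_))
    · rw [Set.ofPred_forall]
      exact Set.definable_iInter_of_finite fun p => definable_pred hS (.proj _)
    · rw [Set.ofPred_forall]
      exact Set.definable_iInter_of_finite fun i => Set.DefinableFun.ofPred_eq (.proj _)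
        (buchi_definableFun_sum _ fun j => buchi_definableFun_const_mul _ (.proj _))
    · exact Set.Definable.preimage_comp Sum.inr (Set.empty_definable_iff.2 ⟨φ', rfl⟩)
  obtain ⟨ψ, hψ⟩ := Set.empty_definable_iff.1 key
  refine ⟨ψ, fun w => (Set.ext_iff.1 hψ (Function.uncurry w)).symm.trans ⟨?_, ?_⟩⟩
  · rintro ⟨s, hs, hw, hr⟩
    choose v hv using hs
    obtain rfl : spread n m ∘ v = s := funext hv
    refine ⟨fun i j => v (i, j), fun i => funext fun j => ?_, (hφ'' v).1 hr⟩
    rw [Subsingleton.elim j 0]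
    exact hw i
  · rintro ⟨v, hw, hr⟩
    refine ⟨spread n m ∘ Function.uncurry v, fun p => ⟨_, rfl⟩, fun i => ?_, (hφ'' _).2 hr⟩
    exact congrFun (hw i) 0

end Translation

/-! ### Moving an interpretation along an injection of tuples -/

namespace Interpretation

variable {K : FirstOrder.Language} {L : FirstOrder.Language} {B : Type*} [L.Structure B]
  {m m' : ℕ}

/-- If `E` is an injection of `m`-tuples into `m'`-tuples and the images under `E` of the definable
relations between `m`-tuples are definable, then an interpretation in dimension `m` can be moved
to dimension `m'`. The pairing `E` itself need not be definable. -/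
theorem exists_equiv_of_injective (E : (Fin m → B) → Fin m' → B) (hE : Function.Injective E)
    (H : ∀ (γ : Type) [Finite γ] (φ : L.Formula (γ × Fin m)), ∃ ψ : L.Formula (γ × Fin m'),
      ∀ w : γ → Fin m' → B, ψ.Realize (Function.uncurry w) ↔
        ∃ v : γ → Fin m → B, (∀ i, w i = E (v i)) ∧ φ.Realize (Function.uncurry v))
    (ι : Interpretation K L B m) :
    ∃ ι' : Interpretation K L B m', Nonempty (ι.InternalModel ≃[K] ι'.InternalModel) := by
  have hdom : ∃ ψ : L.Formula (Fin m'),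
      ∀ w, ψ.Realize w ↔ ∃ a, w = E a ∧ ι.dom.Realize a := by
    obtain ⟨ψ, hψ⟩ := H Unit (ι.dom.relabel fun j => ((), j))
    refine ⟨ψ.relabel Prod.snd, fun w => ?_⟩
    rw [Formula.realize_relabel]
    refine (hψ fun _ => w).trans ⟨?_, ?_⟩
    · rintro ⟨v, hv, hr⟩
      exact ⟨v (), hv (), (Formula.realize_relabel (g := fun j => ((), j))).1 hr⟩
    · rintro ⟨a, ha, hr⟩
      exact ⟨fun _ => a, fun _ => ha, Formula.realize_relabel.2 hr⟩
  have hrel : ∀ {k : ℕ} (R : K.Relations k), ∃ ψ : L.Formula (Fin k × Fin m'),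
      ∀ x, ψ.Realize (Function.uncurry fun i => E (x i)) ↔
        (ι.rel R).Realize (Function.uncurry x) := fun {k} R => by
    obtain ⟨ψ, hψ⟩ := H (Fin k) (ι.rel R)
    refine ⟨ψ, fun x => (hψ _).trans ⟨?_, fun h => ⟨x, fun _ => rfl, h⟩⟩⟩
    rintro ⟨v, hv, hr⟩
    rwa [show x = v from funext fun i => hE (hv i)]
  have hfunc : ∀ {k : ℕ} (φ : L.Formula ((Fin k × Fin m) ⊕ Fin m)),
      ∃ ψ : L.Formula ((Fin k × Fin m') ⊕ Fin m'),
      ∀ x y, ψ.Realize (Sum.elim (Function.uncurry fun i => E (x i)) (E y)) ↔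
        φ.Realize (Sum.elim (Function.uncurry x) y) := fun {k} φ => by
    obtain ⟨ψ, hψ⟩ := H (Option (Fin k)) (φ.relabel
      (Sum.elim (fun p => (some p.1, p.2)) fun j => (none, j)))
    refine ⟨ψ.relabel fun p => p.1.elim (Sum.inr p.2) fun i => Sum.inl (i, p.2), fun x y => ?_⟩
    rw [Formula.realize_relabel]
    have h1 : ∀ (d : ℕ) (z : Fin k → Fin d → B) (u : Fin d → B),
        (Function.uncurry fun o : Option (Fin k) => o.elim u z) ∘
          Sum.elim (fun p : Fin k × Fin d => (some p.1, p.2)) (fun j => (none, j)) =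
        Sum.elim (Function.uncurry z) u := fun d z u => by
      funext p
      rcases p with p | p <;> rfl
    have h2 : Sum.elim (Function.uncurry fun i => E (x i)) (E y) ∘
        (fun p : Option (Fin k) × Fin m' => p.1.elim (Sum.inr p.2) fun i => Sum.inl (i, p.2)) =
        Function.uncurry fun o : Option (Fin k) => o.elim (E y) fun i => E (x i) := by
      funext ⟨o, j⟩
      cases o <;> rfl
    rw [h2, hψ]
    constructor
    · rintro ⟨v, hv, hr⟩
      obtain rfl : v = fun o => o.elim y x := by
        funext o
        refine hE ((hv o).symm.trans ?_)
        cases o <;> rfl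
      rwa [Formula.realize_relabel, h1] at hr
    · intro h
      refine ⟨fun o => o.elim y x, fun o => by cases o <;> rfl, ?_⟩
      rwa [Formula.realize_relabel, h1]
  have heq : ∃ ψ : L.Formula (Fin m' ⊕ Fin m'),
      ∀ a b, ψ.Realize (Sum.elim (E a) (E b)) ↔ ι.eq.Realize (Sum.elim a b) := by
    obtain ⟨ψ, hψ⟩ := hfunc (k := 1) (ι.eq.relabel (Sum.map (fun j => (0, j)) id))
    refine ⟨ψ.relabel (Sum.map Prod.snd id), fun a b => ?_⟩
    have h := hψ (fun _ => a) b
    rw [Formula.realize_relabel, Sum.elim_comp_map] at h ⊢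
    exact h
  obtain ⟨dom', hdom'⟩ := hdom
  obtain ⟨eq', heq'⟩ := heq
  choose rel' hrel' using @hrel
  choose func' hfunc' using fun {k : ℕ} (f : K.Functions k) => hfunc (ι.func f)
  have hd : ∀ a, dom'.Realize (E a) ↔ ι.dom.Realize a := fun a => by
    rw [hdom']
    exact ⟨fun ⟨b, hb, h⟩ => hE hb ▸ h, fun h => ⟨a, rfl, h⟩⟩
  -- a tuple of the new domain is in the range of `E`
  have hx : ∀ {k : ℕ} {x : Fin k → Fin m' → B}, (∀ i, dom'.Realize (x i)) →
      ∃ a : Fin k → Fin m → B, x = (fun i => E (a i)) ∧ ∀ i, ι.dom.Realize (a i) := by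
    intro k x h
    choose a ha hr using fun i => (hdom' (x i)).1 (h i)
    exact ⟨a, funext ha, hr⟩
  let ι' : Interpretation K L B m' :=
    { dom := dom'
      eq := eq'
      rel := fun R => rel' R
      func := fun f => func' f
      eq_refl := fun a ha => by
        obtain ⟨a, rfl, ia⟩ := (hdom' a).1 ha
        exact (heq' a a).2 (ι.eq_refl a ia)
      eq_symm := fun a b ha hb h => by
        obtain ⟨a, rfl, ia⟩ := (hdom' a).1 ha
        obtain ⟨b, rfl, ib⟩ := (hdom' b).1 hb
        exact (heq' _ _).2 (ι.eq_symm _ _ ia ib ((heq' _ _).1 h))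
      eq_trans := fun a b c ha hb hc h h' => by
        obtain ⟨a, rfl, ia⟩ := (hdom' a).1 ha
        obtain ⟨b, rfl, ib⟩ := (hdom' b).1 hb
        obtain ⟨c, rfl, ic⟩ := (hdom' c).1 hc
        exact (heq' _ _).2 (ι.eq_trans _ _ _ ia ib ic ((heq' _ _).1 h) ((heq' _ _).1 h'))
      rel_congr := fun R x x' h h' he hr => by
        obtain ⟨x, rfl, ix⟩ := hx h
        obtain ⟨x', rfl, ix'⟩ := hx h'
        exact (hrel' R _).2 (ι.rel_congr R _ _ ix ix' (fun i => (heq' _ _).1 (he i))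
          ((hrel' R _).1 hr))
      func_congr := fun f x x' y y' h h' hy hy' he hey hr => by
        obtain ⟨x, rfl, ix⟩ := hx h
        obtain ⟨x', rfl, ix'⟩ := hx h'
        obtain ⟨y, rfl, iy⟩ := (hdom' y).1 hy
        obtain ⟨y', rfl, iy'⟩ := (hdom' y').1 hy'
        exact (hfunc' f _ _).2 (ι.func_congr f _ _ _ _ ix ix' iy iy' (fun i => (heq' _ _).1 (he i))
          ((heq' _ _).1 hey) ((hfunc' f _ _).1 hr))
      func_total := fun f x h => by
        obtain ⟨x, rfl, ix⟩ := hx h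
        obtain ⟨y, hy, hr⟩ := ι.func_total f x ix
        exact ⟨E y, (hd y).2 hy, (hfunc' f _ _).2 hr⟩
      func_unique := fun f x y y' h hy hy' hr hr' => by
        obtain ⟨x, rfl, ix⟩ := hx h
        obtain ⟨y, rfl, iy⟩ := (hdom' y).1 hy
        obtain ⟨y', rfl, iy'⟩ := (hdom' y').1 hy'
        exact (heq' _ _).2 (ι.func_unique f _ _ _ ix iy iy' ((hfunc' f _ _).1 hr)
          ((hfunc' f _ _).1 hr')) }
  let e : ι.Dom → ι'.Dom := fun a => ⟨E a.1, (hd a.1).2 a.2⟩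
  have he : ∀ a b, ι'.cls (e a) = ι'.cls (e b) ↔ ι.cls a = ι.cls b := fun a b => by
    rw [cls_eq_cls, cls_eq_cls]
    exact heq' _ _
  let F : ι.InternalModel → ι'.InternalModel := fun x => ι'.cls (e x.out)
  have hF : ∀ a, F (ι.cls a) = ι'.cls (e a) := fun a =>
    (he _ _).2 (Quotient.out_eq (ι.cls a))
  have hbij : Function.Bijective F := by
    constructor
    · intro x y h
      obtain ⟨a, rfl⟩ := ι.cls_surjective x
      obtain ⟨b, rfl⟩ := ι.cls_surjective y
      rwa [hF, hF, he] at h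
    · intro y
      obtain ⟨⟨b, hb⟩, rfl⟩ := ι'.cls_surjective y
      obtain ⟨a, rfl, ha⟩ := (hdom' b).1 hb
      exact ⟨ι.cls ⟨a, ha⟩, hF _⟩
  have hrep : ∀ {k : ℕ} (x : Fin k → ι.InternalModel), ∃ a : Fin k → ι.Dom, x = fun i => ι.cls (a i) :=
    fun x => ⟨fun i => (x i).out, funext fun i => (Quotient.out_eq (x i)).symm⟩
  refine ⟨ι', ⟨{ Equiv.ofBijective F hbij with
    map_fun' := fun {k} f x => ?_
    map_rel' := fun {k} R x => ?_ }⟩⟩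
  · obtain ⟨a, rfl⟩ := hrep x
    obtain ⟨b, hb⟩ := ι.cls_surjective (Structure.funMap f fun i => ι.cls (a i))
    have h1 := (ι.funMap_cls f a b).1 hb.symm
    have h2 := (ι'.funMap_cls f (fun i => e (a i)) (e b)).2 ((hfunc' f _ _).2 h1)
    change F (Structure.funMap f fun i => ι.cls (a i)) =
      Structure.funMap f fun i => F (ι.cls (a i))
    simp_rw [← hb, hF, h2]
  · obtain ⟨a, rfl⟩ := hrep x
    change Structure.RelMap R (fun i => F (ι.cls (a i))) ↔ _
    simp_rw [hF]
    rw [relMap_cls, relMap_cls]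
    exact hrel' R _

end Interpretation

/-! ### Reduction to dimension one -/

theorem mainTheorem2 {K : FirstOrder.Language} (n m : ℕ) (hn : 2 ≤ n) (hm : 2 ≤ m)
    (A : Type*) [K.Structure A] (ι : Interpretation K (buchi n) ℕ m)
    (hA : Nonempty (A ≃[K] ι.InternalModel)) :
    ∃ ι' : Interpretation K (buchi n) ℕ 1,
      Nonempty (ι.InternalModel ≃[K] ι'.InternalModel) ∧
      Nonempty (A ≃[K] ι'.InternalModel) := by
  obtain ⟨ι', ⟨e⟩⟩ := ι.exists_equiv_of_injective (fun a (_ : Fin 1) => interleave n m a)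
    (fun a b h => interleave_injective hn (congrFun h 0)) (exists_interleave_translation hn hm)
  obtain ⟨f⟩ := hA
  exact ⟨ι', ⟨e⟩, ⟨e.comp f⟩⟩
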